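/- All graphs are finite, simple and undirected, with at least one vertex. A \emph{module} of $G=(V,E)$ is a set $M\subseteq V$ with $N(x)\setminus M=N(y)\setminus M$ for all $x,y\in M$; $G$ is \emph{prime} if its only modules are $\emptyset$, the singletons and $V$. A \emph{realizer} of $G$ is a family of closed real intervals $I(v)=[\ell_v,\ell_v+1]$, $v\in V$, such that distinct vertices $u,v$ are adjacent if and only if $I(u)\cap I(v)\ne\emptyset$; $G$ is a \emph{unit interval graph} (UIG) if it has a realizer. A vertex $r$ is an \emph{anchor} if $\ell_r=\min_v \ell_v$ in some realizer of $G$. The minimum-degree breadth-first search $\mathtt{minBFS}(r)$ is a BFS with a queue that starts at $r$: each time a vertex is visited (removed from the head of the queue), those of its neighbours that are neither visited nor in the queue are appended to the queue in nondecreasing order of degree, ties being broken arbitrarily; if the queue becomes empty while unvisited vertices remain, the search restarts from an unvisited vertex of minimum degree. \textbf{Theorem.} Let $G$ be a prime unit interval graph. There is a total ordering $\sigma$ of $V$ such that, for each of the following six kinds of total orderings of $V$, the orderings of that kind are exactly $\sigma$ and its reverse: \begin{enumerate} \item interval orderings: orderings of $V$ by nondecreasing left bound $\ell_v$ of the intervals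 of some realizer of $G$; \item consecutive neighbourhood orderings: for every vertex $v$, the closed neighbourhood $N[v]$ occurs consecutively; \item Left (Left-Right) orderings: whenever $a<b<c$ and $ac\in E$, also $ab\in E$ and $bc\in E$; \item visit orderings of $\mathtt{minBFS}(r)$, where $r$ is an anchor of $G$; \item indifference orderings: whenever $ab,bc\in E$, $a\neq c$ and $ac\notin E$, either $a<b<c$ or $c<b<a$; \item bisimplicial elimination orderings: for every vertex $v$, the neighbours of $v$ that precede $v$ form a clique, and the neighbours of $v$ that follow $v$ form a clique. \end{enumerate} -/

import Mathlib

namespace UIGOrder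

variable {V : Type*}

/-- A module of `G`: all the vertices of `M` have the same neighbours outside `M`. -/
def IsModule (G : SimpleGraph V) (M : Set V) : Prop :=
  ∀ x ∈ M, ∀ y ∈ M, G.neighborSet x \ M = G.neighborSet y \ M

/-- A graph is prime when its only modules are the empty set, the singletons and the whole
vertex set. -/
def IsPrimeGraph (G : SimpleGraph V) : Prop :=
  ∀ M : Set V, IsModule G M → M = ∅ ∨ (∃ x, M = {x}) ∨ M = Set.univ

/-- The closed interval of length one whose left bound is `t`. -/
def unitLengthInterval (t : ℝ) : Set ℝ := Set.Icc t (t + 1)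

/-- The family of unit intervals with left bounds `l v`, for `v : V`, is a realizer of `G`: two
distinct vertices are adjacent exactly when their intervals meet. -/
def IsRealizer (G : SimpleGraph V) (l : V → ℝ) : Prop :=
  ∀ u v, u ≠ v → (G.Adj u v ↔ (unitLengthInterval (l u) ∩ unitLengthInterval (l v)).Nonempty)

/-- Unit interval graphs. -/
def IsUIG (G : SimpleGraph V) : Prop := ∃ l : V → ℝ, IsRealizer G l

/-- An anchor is a vertex whose interval is leftmost in some realizer. -/
def IsAnchor (G : SimpleGraph V) (r : V) : Prop :=
  ∃ l : V → ℝ, IsRealizer G l ∧ ∀ v, l r ≤ l v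

variable [Fintype V]

/-- A total ordering of the vertices: `τ v` is the position of `v`. -/
abbrev VOrdering (V : Type*) [Fintype V] := V ≃ Fin (Fintype.card V)

/-- The mirror ordering. -/
def mirror (τ : VOrdering V) : VOrdering V := τ.trans Fin.revPerm

/-- The ordering lists the intervals of some realizer by nondecreasing left bound. -/
def IsIntervalOrdering (G : SimpleGraph V) (τ : VOrdering V) : Prop :=
  ∃ l : V → ℝ, IsRealizer G l ∧ ∀ u v, τ u < τ v → l u ≤ l v

/-- Every closed neighbourhood occupies consecutive positions. -/
def IsConsecutiveNeighbourhoodOrdering (G : SimpleGraph V) (τ : VOrdering V) : Prop :=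
  ∀ v, (τ '' insert v (G.neighborSet v)).OrdConnected

/-- Left (also called Left-Right) orderings. -/
def IsLeftOrdering (G : SimpleGraph V) (τ : VOrdering V) : Prop :=
  ∀ a b c, τ a < τ b → τ b < τ c → G.Adj a c → G.Adj a b ∧ G.Adj b c

/-- In every induced path on three vertices, the centre lies between the two ends. -/
def IsIndifferenceOrdering (G : SimpleGraph V) (τ : VOrdering V) : Prop :=
  ∀ a b c, a ≠ c → G.Adj a b → G.Adj b c → ¬ G.Adj a c →
    (τ a < τ b ∧ τ b < τ c) ∨ (τ c < τ b ∧ τ b < τ a)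

/-- The neighbours of any vertex that precede it form a clique. -/
def IsSimplicialEliminationOrdering (G : SimpleGraph V) (τ : VOrdering V) : Prop :=
  ∀ v, G.IsClique {u | G.Adj v u ∧ τ u < τ v}

/-- The ordering and its mirror are both simplicial elimination orderings. -/
def IsBisimplicialEliminationOrdering (G : SimpleGraph V) (τ : VOrdering V) : Prop :=
  IsSimplicialEliminationOrdering G τ ∧ IsSimplicialEliminationOrdering G (mirror τ)

/-- `MinBFSReach G x L Q`: some run of the breadth-first search with minimum degree priority that
starts at `x` reaches the state in which `L` is the list of visited vertices, in the order of their
visits, and `Q` is the queue. -/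
inductive MinBFSReach (G : SimpleGraph V) [DecidableRel G.Adj] (x : V) :
    List V → List V → Prop
  /-- At first nothing is visited and the queue holds `x` alone. -/
  | start : MinBFSReach G x [] [x]
  /-- The head `u` of the queue is visited, and its neighbours that are neither visited nor in the
  queue are put at the end of the queue, by nondecreasing degree. -/
  | visit (L Q N : List V) (u : V) (h : MinBFSReach G x L (u :: Q)) (hN : N.Nodup)
      (hmem : ∀ w, w ∈ N ↔ G.Adj u w ∧ w ∉ L ∧ w ∉ u :: Q)
      (hdeg : N.Pairwise fun v w => G.degree v ≤ G.degree w) :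
      MinBFSReach G x (L ++ [u]) (Q ++ N)
  /-- When the queue is empty before all the vertices are visited (a component is exhausted), the
  search goes on from an unvisited vertex of minimum degree. -/
  | restart (L : List V) (v : V) (h : MinBFSReach G x L []) (hv : v ∉ L)
      (hdeg : ∀ w, w ∉ L → G.degree v ≤ G.degree w) :
      MinBFSReach G x L [v]

/-- `τ` is the visit ordering of a complete run of minBFS that starts at `x`. -/
def IsMinBFSOrdering (G : SimpleGraph V) [DecidableRel G.Adj] (x : V) (τ : VOrdering V) : Prop :=
  MinBFSReach G x (List.ofFn τ.symm) []

end UIGOrder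

/-! Everything is compared with left orderings. They coincide with consecutive neighbourhood
orderings in every graph, as indifference orderings do with bisimplicial ones. Left orderings are
indifference orderings; the converse needs connectedness, which primality gives beyond two vertices.
Sorting one realizer yields a left ordering `σ`, and negating its bounds yields the mirror. So it is
enough that left orderings are unique up to reversal; no realizer is ever built from an ordering.
Uniqueness has two parts. The first vertex of a left ordering is an end of any other
(`IsPrimeGraph.first_eq_end`). From the first vertex of a left ordering, minBFS can only output that
ordering, since degree ties would create twins (`MinBFSReach.sorted`). Hence two left orderings, one
mirrored if needed, are outputs of the same search. Anchors are also ends of `σ`, which settles the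
minBFS orderings. -/

namespace UIGOrder

/-! ### Modules of prime graphs: twins and connectedness -/

section Structure

variable {V : Type*} {G : SimpleGraph V}

/-- The vertex set has at most two elements. -/
def AtMostTwo (V : Type*) : Prop := ∃ x y : V, ∀ z, z = x ∨ z = y

theorem AtMostTwo.eq_or_eq_or_eq (h : AtMostTwo V) (a b c : V) : a = b ∨ b = c ∨ a = c := by
  obtain ⟨x, y, h⟩ := h
  rcases h a with rfl | rfl <;> rcases h b with rfl | rfl <;> rcases h c with rfl | rfl <;> simp

/-- Twins form a two-element module, which in a prime graph must be all of `V`. Most uses of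
primality below go through this. -/
theorem IsPrimeGraph.atMostTwo_of_twins (hp : IsPrimeGraph G) {x y : V} (hxy : x ≠ y)
    (h : ∀ z, z ≠ x → z ≠ y → (G.Adj x z ↔ G.Adj y z)) : AtMostTwo V := by
  have hm : IsModule G {x, y} := by
    intro a ha b hb
    ext z
    simp only [Set.mem_insert_iff, Set.mem_singleton_iff] at ha hb
    simp only [Set.mem_sdiff, SimpleGraph.mem_neighborSet, Set.mem_insert_iff,
      Set.mem_singleton_iff, not_or]
    rcases ha with rfl | rfl <;> rcases hb with rfl | rfl <;> grind
  rcases hp _ hm with h0 | ⟨z, hz⟩ | h1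
  · exact absurd h0 (Set.insert_nonempty _ _).ne_empty
  · have h2 : x ∈ ({z} : Set V) := hz ▸ Set.mem_insert x {y}
    have h3 : y ∈ ({z} : Set V) := hz ▸ Set.mem_insert_of_mem x rfl
    exact absurd (h2.trans h3.symm) hxy
  · refine ⟨x, y, fun z => ?_⟩
    have : z ∈ ({x, y} : Set V) := h1 ▸ Set.mem_univ z
    simpa using this

/-- A set of vertices joined by no edge to its complement is trivial in a prime graph, unless the
set and its complement are both singletons. -/
theorem IsPrimeGraph.eq_singletons_of_no_edges (hp : IsPrimeGraph G) {S : Set V}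
    (hS : ∀ x ∈ S, ∀ y ∉ S, ¬ G.Adj x y) {u v : V} (hu : u ∈ S) (hv : v ∉ S) :
    ∀ z, (z ∈ S → z = u) ∧ (z ∉ S → z = v) := by
  have hm : IsModule G S := by
    intro a ha b hb
    ext z
    simp only [Set.mem_sdiff, SimpleGraph.mem_neighborSet]
    grind
  have hm' : IsModule G Sᶜ := by
    intro a ha b hb
    ext z
    simp only [Set.mem_sdiff, SimpleGraph.mem_neighborSet, Set.mem_compl_iff] at *
    have := fun h : z ∈ S => hS z h a ha
    have := fun h : z ∈ S => hS z h b hb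
    grind [SimpleGraph.adj_comm]
  intro z
  constructor
  · intro hz
    rcases hp _ hm with h | ⟨w, h⟩ | h
    · simp [h] at hu
    · simp only [h, Set.mem_singleton_iff] at hu hz
      rw [hu, hz]
    · simp [h] at hv
  · intro hz
    have hz' : z ∈ Sᶜ := hz
    have hv' : v ∈ Sᶜ := hv
    rcases hp _ hm' with h | ⟨w, h⟩ | h
    · simp [h] at hv'
    · simp only [h, Set.mem_singleton_iff] at hv' hz'
      rw [hv', hz']
    · have : u ∈ Sᶜ := h ▸ Set.mem_univ u
      exact absurd hu this

/-- A nontrivial set of vertices of a prime graph is joined by an edge to its complement. -/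
theorem IsPrimeGraph.exists_adj_crossing (hp : IsPrimeGraph G) (h2 : ¬ AtMostTwo V)
    {S : Set V} {u v : V} (hu : u ∈ S) (hv : v ∉ S) : ∃ x ∈ S, ∃ y ∉ S, G.Adj x y := by
  by_contra! hn
  have := hp.eq_singletons_of_no_edges hn hu hv
  exact h2 ⟨u, v, fun z => by
    by_cases hz : z ∈ S
    · exact Or.inl ((this z).1 hz)
    · exact Or.inr ((this z).2 hz)⟩

theorem IsPrimeGraph.connected (hp : IsPrimeGraph G) [Nonempty V] (h2 : ¬ AtMostTwo V) :
    G.Connected := by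
  refine ⟨fun u v => ?_⟩
  by_contra huv
  obtain ⟨x, hx, y, hy, hxy⟩ := hp.exists_adj_crossing h2 (S := {w | G.Reachable u w})
    (SimpleGraph.Reachable.refl u) huv
  exact hy (SimpleGraph.Reachable.trans hx hxy.reachable)

end Structure

/-! ### Equivalences between the orderings, and their ends -/

section Orderings

variable {V : Type*} [Fintype V] {G : SimpleGraph V} {σ τ : VOrdering V}

theorem mirror_lt_mirror {u v : V} : mirror τ u < mirror τ v ↔ τ v < τ u := by
  simp [mirror]

theorem IsLeftOrdering.mirror (h : IsLeftOrdering G τ) : IsLeftOrdering G (mirror τ) := by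
  intro a b c hab hbc hac
  rw [mirror_lt_mirror] at hab hbc
  have := h c b a hbc hab hac.symm
  exact ⟨this.2.symm, this.1.symm⟩

theorem isConsecutiveNeighbourhoodOrdering_iff :
    IsConsecutiveNeighbourhoodOrdering G τ ↔ IsLeftOrdering G τ := by
  constructor
  · intro h a b c hab hbc hac
    have key : ∀ v, a ∈ insert v (G.neighborSet v) → c ∈ insert v (G.neighborSet v) →
        b ∈ insert v (G.neighborSet v) := fun v ha hc =>
      (τ.injective.mem_set_image).1 ((h v).out (Set.mem_image_of_mem τ ha)
        (Set.mem_image_of_mem τ hc) ⟨hab.le, hbc.le⟩)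
    have h1 := key a (Set.mem_insert _ _) (Set.mem_insert_of_mem _ hac)
    have h2 := key c (Set.mem_insert_of_mem _ hac.symm) (Set.mem_insert _ _)
    simp only [Set.mem_insert_iff, SimpleGraph.mem_neighborSet] at h1 h2
    refine ⟨h1.resolve_left ?_, (h2.resolve_left ?_).symm⟩
    · rintro rfl; exact lt_irrefl _ hab
    · rintro rfl; exact lt_irrefl _ hbc
  · intro h v
    refine ⟨?_⟩
    rintro _ ⟨x, hx, rfl⟩ _ ⟨z, hz, rfl⟩ p ⟨hxp, hpz⟩
    obtain ⟨y, rfl⟩ := τ.surjective p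
    refine Set.mem_image_of_mem τ ?_
    rcases hxp.eq_or_lt with e | hxy
    · rwa [← τ.injective e]
    rcases hpz.eq_or_lt with e | hyz
    · rwa [τ.injective e]
    simp only [Set.mem_insert_iff, SimpleGraph.mem_neighborSet] at *
    by_cases hyv : y = v
    · exact Or.inl hyv
    right
    rcases lt_or_gt_of_ne (fun e => hyv (τ.injective e)) with hlt | hgt
    · have hxv : x ≠ v := by rintro rfl; exact lt_asymm hxy hlt
      exact (h x y v hxy hlt (hx.resolve_left hxv).symm).2.symm
    · have hzv : z ≠ v := by rintro rfl; exact lt_asymm hyz hgt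
      exact (h v y z hgt hyz (hz.resolve_left hzv)).1

theorem isBisimplicialEliminationOrdering_iff :
    IsBisimplicialEliminationOrdering G τ ↔ IsIndifferenceOrdering G τ := by
  simp only [IsBisimplicialEliminationOrdering, IsSimplicialEliminationOrdering,
    SimpleGraph.isClique_iff, Set.Pairwise, mirror_lt_mirror, Set.mem_ofPred_eq]
  constructor
  · rintro ⟨h1, h2⟩ a b c hac hab hbc hnac
    have h1' := fun p q => h1 b ⟨hab.symm, p⟩ ⟨hbc, q⟩ hac
    have h2' := fun p q => h2 b ⟨hab.symm, p⟩ ⟨hbc, q⟩ hac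
    have ha : τ a ≠ τ b := fun e => hab.ne (τ.injective e)
    have hc : τ c ≠ τ b := fun e => hbc.ne' (τ.injective e)
    grind
  · intro h
    constructor <;>
    · rintro v x ⟨hx, hx'⟩ y ⟨hy, hy'⟩ hxy
      by_contra hn
      rcases h x v y hxy hx.symm hy hn with ⟨p, q⟩ | ⟨p, q⟩
      · first | exact lt_asymm hy' q | exact lt_asymm hx' p
      · first | exact lt_asymm hx' q | exact lt_asymm hy' p

theorem IsLeftOrdering.isIndifferenceOrdering (h : IsLeftOrdering G τ) :
    IsIndifferenceOrdering G τ := by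
  intro a b c hac hab hbc hn
  have ha : τ a ≠ τ b := fun e => hab.ne (τ.injective e)
  have hc : τ c ≠ τ b := fun e => hbc.ne' (τ.injective e)
  have hac' : τ a ≠ τ c := fun e => hac (τ.injective e)
  have h1 := h b a c
  have h2 := h b c a
  have h3 := h a c b
  have h4 := h c a b
  grind [SimpleGraph.adj_comm]

/-- Along a shortest path, an indifference ordering is monotone. -/
theorem IsIndifferenceOrdering.between_of_dist (h : IsIndifferenceOrdering G τ)
    (hc : G.Connected) {b : V} (k : ℕ) : ∀ x y, G.dist b x = k + 2 → G.dist b y = k + 1 →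
      G.Adj y x → (τ b < τ y ∧ τ y < τ x) ∨ (τ x < τ y ∧ τ y < τ b) := by
  induction k with
  | zero =>
    intro x y hx hy hyx
    refine h b y x ?_ (SimpleGraph.dist_eq_one_iff_adj.1 hy) hyx ?_
    · rintro rfl; simp at hx
    · intro e
      have := SimpleGraph.dist_eq_one_iff_adj.2 e
      omega
  | succ k ih =>
    intro x y hx hy hyx
    obtain ⟨p, hp⟩ := hc.exists_walk_length_eq_dist y b
    rw [SimpleGraph.dist_comm, hy] at hp
    cases p with
    | nil => simp at hp
    | @cons _ z _ hyz q =>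
      have hq : q.length = k + 1 := by simpa using hp
      have h1 : G.dist b z ≤ k + 1 := by
        rw [SimpleGraph.dist_comm, ← hq]; exact SimpleGraph.dist_le q
      have hzy := hc.dist_triangle (u := b) (v := z) (w := y)
      rw [SimpleGraph.dist_eq_one_iff_adj.2 hyz.symm] at hzy
      have hz : G.dist b z = k + 1 := by omega
      have hzx : ¬ G.Adj z x := by
        intro e
        have := hc.dist_triangle (u := b) (v := z) (w := x)
        rw [SimpleGraph.dist_eq_one_iff_adj.2 e] at this
        omega
      have hne : z ≠ x := by rintro rfl; omega
      have := ih y z hy hz hyz.symm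
      have := h z y x hne hyz.symm hyx hzx
      grind

/-- If `b` lies between adjacent `a` and `c` and sees just one of them, these three form an induced
path with `b` not at its centre. If it sees neither, `aux` compares shortest paths from `b`, which
are monotone yet would have to reach both sides. -/
theorem IsIndifferenceOrdering.isLeftOrdering_of_connected (h : IsIndifferenceOrdering G τ)
    (hc : G.Connected) : IsLeftOrdering G τ := by
  have aux : ∀ a b c, ((τ a < τ b ∧ τ b < τ c) ∨ (τ c < τ b ∧ τ b < τ a)) → G.Adj a c →
      ¬ G.Adj a b → ¬ G.Adj b c → ¬ G.dist b a ≤ G.dist b c := by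
    intro a b c hlt hac hab hbc hle
    have hba : b ≠ a := by rintro rfl; grind
    have hd0 : G.dist b a ≠ 0 := by
      rw [Ne, hc.dist_eq_zero_iff]; exact hba
    have hd1 : G.dist b a ≠ 1 := by
      rw [Ne, SimpleGraph.dist_eq_one_iff_adj]; exact fun e => hab e.symm
    obtain ⟨k, hk⟩ : ∃ k, G.dist b a = k + 2 := ⟨G.dist b a - 2, by omega⟩
    have htri := hc.dist_triangle (u := b) (v := a) (w := c)
    rw [SimpleGraph.dist_eq_one_iff_adj.2 hac] at htri
    rcases (by omega : G.dist b c = k + 2 ∨ G.dist b c = k + 3) with hkc | hkc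
    · obtain ⟨p, hp⟩ := hc.exists_walk_length_eq_dist a b
      rw [SimpleGraph.dist_comm, hk] at hp
      cases p with
      | nil => simp at hp
      | @cons _ y _ hay q =>
        have hq : q.length = k + 1 := by simpa using hp
        have h1 : G.dist b y ≤ k + 1 := by
          rw [SimpleGraph.dist_comm, ← hq]; exact SimpleGraph.dist_le q
        have hya := hc.dist_triangle (u := b) (v := y) (w := a)
        rw [SimpleGraph.dist_eq_one_iff_adj.2 hay.symm] at hya
        have hy : G.dist b y = k + 1 := by omega
        have h2 := h.between_of_dist hc k a y hk hy hay.symm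
        have hyc : G.Adj y c := by
          by_contra hn
          have := h y a c (by rintro rfl; omega) hay.symm hac hn
          grind
        have := h.between_of_dist hc k c y hkc hy hyc
        grind
    · have := h.between_of_dist hc (k + 1) c a hkc hk hac
      grind
  intro a b c hab hbc hac
  have hne : a ≠ b := by rintro rfl; exact lt_irrefl _ hab
  have hne' : b ≠ c := by rintro rfl; exact lt_irrefl _ hbc
  have h1 := h b a c
  have h2 := h a c b
  have h3 := aux a b c
  have h4 := aux c b a
  have := le_total (G.dist b a) (G.dist b c)
  grind [SimpleGraph.adj_comm]

theorem isLeftOrdering_of_atMostTwo (h : AtMostTwo V) : IsLeftOrdering G τ := by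
  intro a b c hab hbc
  rcases h.eq_or_eq_or_eq a b c with rfl | rfl | rfl
  exacts [absurd hab (lt_irrefl _), absurd hbc (lt_irrefl _), absurd hab (lt_asymm hbc)]

theorem IsPrimeGraph.isIndifferenceOrdering_iff [Nonempty V] (hp : IsPrimeGraph G) :
    IsIndifferenceOrdering G τ ↔ IsLeftOrdering G τ := by
  refine ⟨fun h => ?_, IsLeftOrdering.isIndifferenceOrdering⟩
  by_cases h2 : AtMostTwo V
  · exact isLeftOrdering_of_atMostTwo h2
  · exact h.isLeftOrdering_of_connected (hp.connected h2)

theorem exists_first [Nonempty V] (τ : VOrdering V) : ∃ r, ∀ v, τ r ≤ τ v :=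
  Finite.exists_min τ

theorem AtMostTwo.eq_end (h : AtMostTwo V) (r : V) :
    (∀ v, σ r ≤ σ v) ∨ ∀ v, mirror σ r ≤ mirror σ v := by
  simp only [← not_lt, mirror_lt_mirror]
  by_contra! hn
  obtain ⟨⟨a, ha⟩, b, hb⟩ := hn
  rcases h.eq_or_eq_or_eq a r b with rfl | rfl | rfl
  exacts [lt_irrefl _ ha, lt_irrefl _ hb, lt_asymm ha hb]

/-- If the first vertex `f` of `σ` is not adjacent to the first vertex `r` of `τ`, then all the
vertices from `f` on in `τ` precede `r` in `σ`. -/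
theorem IsPrimeGraph.lt_of_first_le (hp : IsPrimeGraph G) (h2 : ¬ AtMostTwo V)
    (hσ : IsLeftOrdering G σ) (hτ : IsLeftOrdering G τ) {r f : V} (hr : ∀ v, τ r ≤ τ v)
    (hf : ∀ v, σ f ≤ σ v) (hrf : r ≠ f) (hn : ¬ G.Adj r f) :
    ∀ n : ℕ, ∀ y, (τ y : ℕ) = n → τ f ≤ τ y → σ y < σ r := by
  intro n
  induction n using Nat.strong_induction_on with
  | _ n ih =>
  intro y hy hfy
  rcases hfy.eq_or_lt with e | hlt
  · rw [← τ.injective e]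
    exact lt_of_le_of_ne (hf r) fun e => hrf (σ.injective e).symm
  obtain ⟨x, hx, z, hz, hxz⟩ := hp.exists_adj_crossing h2 (S := {w | τ w < τ y}) (u := f) (v := y)
    hlt (lt_irrefl (τ y))
  simp only [Set.mem_ofPred_eq, not_lt] at hx hz
  have hxy : G.Adj x y := by
    rcases hz.eq_or_lt with e | hyz
    · rwa [τ.injective e]
    · exact (hτ x y z hx hyz hxz).1
  have hrne : τ r < τ f := lt_of_le_of_ne (hr f) fun e => hrf (τ.injective e)
  have hry : ¬ G.Adj r y := fun e => hn (hτ r f y hrne hlt e).1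
  have hyr : τ r < τ y := hrne.trans hlt
  -- If the neighbour `x` comes before `f` in `τ`, then `f` lies between `x` and `y` and can replace
  -- it.
  obtain ⟨x', hx', hfx', hxy'⟩ : ∃ x', τ x' < τ y ∧ τ f ≤ τ x' ∧ G.Adj x' y := by
    rcases le_or_gt (τ f) (τ x) with hle | hgt
    · exact ⟨x, hx, hle, hxy⟩
    · exact ⟨f, hlt, le_rfl, (hτ x f y hgt hlt hxy).2⟩
  have hσx : σ x' < σ r := ih (τ x') (by rw [← hy]; exact hx') x' rfl hfx'
  by_contra hge
  have hσy : σ r < σ y := lt_of_le_of_ne (not_lt.1 hge) fun e => by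
    rw [σ.injective e] at hyr; exact lt_irrefl _ hyr
  exact hry (hσ x' r y hσx hσy hxy').2

/-- The closed neighbourhood of the first vertex of a left ordering is a clique. Adjacent first
vertices would thus have equal closed neighbourhoods and be twins. -/
theorem IsPrimeGraph.not_adj_first (hp : IsPrimeGraph G) (h2 : ¬ AtMostTwo V)
    (hσ : IsLeftOrdering G σ) (hτ : IsLeftOrdering G τ) {r f : V} (hr : ∀ v, τ r ≤ τ v)
    (hf : ∀ v, σ f ≤ σ v) (hrf : r ≠ f) : ¬ G.Adj r f := by
  intro hadj
  refine h2 (hp.atMostTwo_of_twins hrf fun z hzr hzf => ⟨fun hz => ?_, fun hz => ?_⟩)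
  · have h1 : τ r < τ z := lt_of_le_of_ne (hr z) fun e => hzr (τ.injective e).symm
    have h3 : τ r < τ f := lt_of_le_of_ne (hr f) fun e => hrf (τ.injective e)
    rcases lt_or_gt_of_ne (fun e => hzf (τ.injective e)) with hlt | hgt
    · exact (hτ r z f h1 hlt hadj).2.symm
    · exact (hτ r f z h3 hgt hz).2
  · have h1 : σ f < σ z := lt_of_le_of_ne (hf z) fun e => hzf (σ.injective e).symm
    have h3 : σ f < σ r := lt_of_le_of_ne (hf r) fun e => hrf (σ.injective e).symm
    rcases lt_or_gt_of_ne (fun e => hzr (σ.injective e)) with hlt | hgt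
    · exact (hσ f z r h1 hlt hadj.symm).2.symm
    · exact (hσ f r z h3 hgt hz).2

/-- The first vertex of a left ordering of a prime graph is an end of any other left ordering. -/
theorem IsPrimeGraph.first_eq_end [Nonempty V] (hp : IsPrimeGraph G)
    (hσ : IsLeftOrdering G σ) (hτ : IsLeftOrdering G τ) {r : V} (hr : ∀ v, τ r ≤ τ v) :
    (∀ v, σ r ≤ σ v) ∨ ∀ v, mirror σ r ≤ mirror σ v := by
  obtain ⟨f, hf⟩ := exists_first σ
  obtain ⟨e, he⟩ := exists_first (mirror σ)
  by_cases hrf : r = f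
  · exact Or.inl (hrf ▸ hf)
  by_cases hre : r = e
  · exact Or.inr (hre ▸ he)
  by_cases h2 : AtMostTwo V
  · exact h2.eq_end r
  exfalso
  have hnf := hp.not_adj_first h2 hσ hτ hr hf hrf
  have hne := hp.not_adj_first h2 hσ.mirror hτ hr he hre
  have hef : σ f ≤ σ r := hf r
  have her : σ r ≤ σ e := by
    have := he r
    rwa [← not_lt, mirror_lt_mirror, not_lt] at this
  -- Whichever end of `σ` comes first in `τ`, the other one is forced onto the wrong side of `r`.
  rcases le_total (τ f) (τ e) with hle | hle
  · exact absurd (hp.lt_of_first_le h2 hσ hτ hr hf hrf hnf _ e rfl hle) (not_lt.2 her)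
  · have := hp.lt_of_first_le h2 hσ.mirror hτ hr he hre hne _ f rfl hle
    rw [mirror_lt_mirror] at this
    exact absurd this (not_lt.2 hef)

end Orderings

/-! ### minBFS and uniqueness of the left ordering -/

section Search

variable {V : Type*} [Fintype V] {G : SimpleGraph V} {σ τ : VOrdering V}

/-- A list of vertices that is sorted for `σ` and as long as possible lists `σ`. -/
theorem eq_ofFn_of_pairwise_lt {L : List V} (hL : L.Pairwise fun u v => σ u < σ v)
    (hlen : L.length = Fintype.card V) : L = List.ofFn σ.symm := by
  have hmap : (L.map σ).Pairwise (· < ·) := List.pairwise_map.2 hL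
  have hlen' : (L.map σ).length = Fintype.card V := by simpa using hlen
  have : L.map σ = List.finRange (Fintype.card V) := by
    have hperm : (L.map σ).Perm (List.finRange (Fintype.card V)) := by
      refine (List.subperm_of_subset hmap.nodup fun x _ => List.mem_finRange x).perm_of_length_le ?_
      simp [hlen]
    exact hperm.eq_of_pairwise' hmap (List.pairwise_lt_finRange _)
  have h := congrArg (List.map σ.symm) this
  rw [List.ofFn_eq_map, ← h]
  simp

theorem eq_of_ofFn_symm_eq (h : List.ofFn τ.symm = List.ofFn σ.symm) : τ = σ := by
  have h1 := List.ofFn_injective h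
  have h2 : τ.symm = σ.symm := Equiv.coe_fn_injective h1
  rw [← τ.symm_symm, h2, σ.symm_symm]

variable [DecidableRel G.Adj]

/-- If `u` precedes `w` and `w` precedes `v`, where `v` and `w` are neighbours of `u` without
neighbours before `u`, then the degree of `w` is less than that of `v`. -/
theorem IsPrimeGraph.degree_lt_degree (hp : IsPrimeGraph G) (hσ : IsLeftOrdering G σ) {u w v : V}
    (huw : σ u < σ w) (hwv : σ w < σ v) (huv : G.Adj u v)
    (hbefore : ∀ y, G.Adj w y → σ u ≤ σ y) : G.degree w < G.degree v := by
  classical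
  have hadj := hσ u w v huw hwv huv
  have hsub : ∀ y, y ≠ v → G.Adj w y → G.Adj v y := by
    intro y hyv hwy
    rcases (hbefore y hwy).eq_or_lt with e | huy
    · rw [← σ.injective e]; exact huv.symm
    rcases lt_or_gt_of_ne (fun e => hyv (σ.injective e)) with hlt | hgt
    · exact (hσ u y v huy hlt huv).2.symm
    · exact (hσ w v y hwv hgt hwy).2
  -- Removing `v` and `w` from each other's neighbourhoods makes these comparable by inclusion;
  -- equality would make `v` and `w` twins.
  have hw : G.degree w = ((G.neighborFinset w).erase v).card + 1 := by
    rw [Finset.card_erase_add_one (by simpa using hadj.2), SimpleGraph.card_neighborFinset_eq_degree]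
  have hv : G.degree v = ((G.neighborFinset v).erase w).card + 1 := by
    rw [Finset.card_erase_add_one (by simpa using hadj.2.symm),
      SimpleGraph.card_neighborFinset_eq_degree]
  rw [hw, hv]
  refine Nat.add_lt_add_right (Finset.card_lt_card (Finset.ssubset_iff_subset_ne.2 ⟨?_, ?_⟩)) 1
  · intro y hy
    simp only [Finset.mem_erase, SimpleGraph.mem_neighborFinset] at hy ⊢
    exact ⟨hy.2.ne', hsub y hy.1 hy.2⟩
  · intro he
    have h2 : AtMostTwo V := hp.atMostTwo_of_twins hadj.2.ne fun z hzw hzv => by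
      have := Finset.ext_iff.1 he z
      simpa [hzw, hzv] using this
    rcases h2.eq_or_eq_or_eq u w v with e | e | e
    exacts [hadj.1.ne e, hadj.2.ne e, huv.ne e]

/-- A run of minBFS from the first vertex of a left ordering of a prime graph visits the vertices
in that order. -/
theorem MinBFSReach.sorted (hp : IsPrimeGraph G) (hσ : IsLeftOrdering G σ) {r : V}
    (hr : ∀ v, σ r ≤ σ v) {L Q : List V} (h : MinBFSReach G r L Q) :
    (L ++ Q).Pairwise (fun u v => σ u < σ v) ∧
    (∀ v ∈ L ++ Q, ∀ u, σ u < σ v → u ∈ L ++ Q) ∧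
    (∀ u ∈ L, ∀ w, G.Adj u w → w ∈ L ++ Q) ∧ r ∈ L ++ Q := by
  induction h with
  | start =>
    refine ⟨by simp, ?_, by simp, by simp⟩
    intro v hv u hu
    simp only [List.nil_append, List.mem_singleton] at hv
    subst hv
    exact absurd hu (not_lt.2 (hr u))
  | visit L Q N u h hN hmem hdeg ih =>
    obtain ⟨hs, hd, hc, hrm⟩ := ih
    have hassoc : (L ++ [u]) ++ (Q ++ N) = (L ++ u :: Q) ++ N := by simp
    rw [hassoc]
    have hnew : ∀ w, w ∈ N ↔ G.Adj u w ∧ w ∉ L ++ u :: Q := by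
      intro w; rw [hmem]; simp [not_or]
    have hlate : ∀ x ∈ L ++ u :: Q, ∀ w ∉ L ++ u :: Q, σ x < σ w := by
      intro x hx w hw
      by_contra hlt
      rcases (not_lt.1 hlt).eq_or_lt with e | hlt
      · exact hw (σ.injective e ▸ hx)
      · exact hw (hd x hx w hlt)
    have hu : u ∈ L ++ u :: Q := by simp
    have hL : ∀ y, y ∉ L → σ u ≤ σ y := by
      intro y hy
      by_cases hyo : y ∈ L ++ u :: Q
      · rcases List.mem_append.1 hyo with h1 | h1
        · exact absurd h1 hy
        rcases List.mem_cons.1 h1 with rfl | h1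
        · exact le_rfl
        · exact ((List.pairwise_cons.1 (List.pairwise_append.1 hs).2.1).1 y h1).le
      · exact (hlate u hu y hyo).le
    refine ⟨List.pairwise_append.2 ⟨hs, ?_, fun x hx w hw => hlate x hx w ((hnew w).1 hw).2⟩,
      ?_, ?_, List.mem_append_left _ hrm⟩
    · refine ((hN.and hdeg).imp_of_mem ?_)
      rintro v w hv hw ⟨hne, hle⟩
      rw [hnew] at hv hw
      by_contra hlt
      have hwv : σ w < σ v := lt_of_le_of_ne (not_lt.1 hlt) fun e => hne (σ.injective e).symm
      refine absurd (hp.degree_lt_degree hσ (hlate u hu w hw.2) hwv hv.1 fun y hy => hL y ?_)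
        (not_lt.2 hle)
      exact fun hyL => hw.2 (hc y hyL w hy.symm)
    · intro w hw x hx
      by_cases hxo : x ∈ L ++ u :: Q
      · exact List.mem_append_left _ hxo
      rcases List.mem_append.1 hw with hw | hw
      · exact List.mem_append_left _ (hd w hw x hx)
      · exact List.mem_append_right _ ((hnew x).2
          ⟨(hσ u x w (hlate u hu x hxo) hx ((hnew w).1 hw).1).1, hxo⟩)
    · intro x hx w hw
      by_cases hwo : w ∈ L ++ u :: Q
      · exact List.mem_append_left _ hwo
      rcases List.mem_append.1 hx with hx | hx
      · exact List.mem_append_left _ (hc x hx w hw)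
      · rw [List.mem_singleton.1 hx] at hw
        exact List.mem_append_right _ ((hnew w).2 ⟨hw, hwo⟩)
  | restart L v h hv hdeg ih =>
    simp only [List.append_nil] at ih
    obtain ⟨hs, hd, hc, hrm⟩ := ih
    -- No edge leaves the visited set, so primality leaves `v` as the only unvisited vertex.
    have hpart := hp.eq_singletons_of_no_edges (S := {x | x ∈ L})
      (fun x hx y hy hxy => hy (hc x hx y hxy)) hrm hv
    refine ⟨List.pairwise_append.2 ⟨hs, by simp, ?_⟩, ?_, fun x hx w hw =>
      List.mem_append_left _ (hc x hx w hw), List.mem_append_left _ hrm⟩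
    · intro x hx w hw
      rw [List.mem_singleton.1 hw]
      by_contra hlt
      rcases (not_lt.1 hlt).eq_or_lt with e | hlt
      · exact hv (σ.injective e ▸ hx)
      · exact hv (hd x hx v hlt)
    · intro w _ x _
      by_cases hx : x ∈ L
      · exact List.mem_append_left _ hx
      · exact List.mem_append_right _ (List.mem_singleton.2 ((hpart x).2 hx))

theorem MinBFSReach.exists_visit {r u : V} {L Q : List V} (h : MinBFSReach G r L (u :: Q)) :
    ∃ Q', MinBFSReach G r (L ++ [u]) Q' := by
  classical
  let s : Finset V := Finset.univ.filter fun w => G.Adj u w ∧ w ∉ L ∧ w ∉ u :: Q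
  let R : V → V → Prop := fun v w => G.degree v ≤ G.degree w
  have : Std.Total R := ⟨fun v w => le_total (G.degree v) (G.degree w)⟩
  have : IsTrans V R := ⟨fun _ _ _ => le_trans⟩
  have hperm := List.perm_insertionSort R s.toList
  refine ⟨_, h.visit L Q (s.toList.insertionSort R) u (hperm.nodup_iff.2 s.nodup_toList) ?_
    (List.pairwise_insertionSort R _)⟩
  intro w
  rw [hperm.mem_iff]
  simp [s]

theorem MinBFSReach.exists_length (G : SimpleGraph V) [DecidableRel G.Adj] (r : V) (n : ℕ) :
    n ≤ Fintype.card V → ∃ L Q, MinBFSReach G r L Q ∧ L.length = n := by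
  classical
  induction n with
  | zero => exact fun _ => ⟨[], [r], .start, rfl⟩
  | succ n ih =>
    intro hn
    obtain ⟨L, Q, h, hlen⟩ := ih (by omega)
    cases Q with
    | cons u Q =>
      obtain ⟨Q', h'⟩ := h.exists_visit
      exact ⟨_, Q', h', by simp [hlen]⟩
    | nil =>
      have hne : (Finset.univ.filter fun v => v ∉ L).Nonempty := by
        by_contra hempty
        have hall : ∀ v, v ∈ L := by
          simpa [Finset.filter_eq_empty_iff] using Finset.not_nonempty_iff_eq_empty.1 hempty
        have h1 : (Finset.univ : Finset V) ⊆ L.toFinset := fun v _ => by simpa using hall v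
        have h3 := (Finset.card_le_card h1).trans L.toFinset_card_le
        rw [Finset.card_univ] at h3
        omega
      obtain ⟨v, hv, hmin⟩ := Finset.exists_min_image _ (fun v => G.degree v) hne
      simp only [Finset.mem_filter, Finset.mem_univ, true_and] at hv hmin
      obtain ⟨Q', h'⟩ := (h.restart L v hv hmin).exists_visit
      exact ⟨_, Q', h', by simp [hlen]⟩

theorem IsPrimeGraph.isMinBFSOrdering_iff (hp : IsPrimeGraph G) (hσ : IsLeftOrdering G σ) {r : V}
    (hr : ∀ v, σ r ≤ σ v) : IsMinBFSOrdering G r τ ↔ τ = σ := by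
  constructor
  · intro h
    have hs := (MinBFSReach.sorted hp hσ hr h).1
    rw [List.append_nil] at hs
    exact eq_of_ofFn_symm_eq (eq_ofFn_of_pairwise_lt hs (by simp))
  · rintro rfl
    obtain ⟨L, Q, h, hlen⟩ := MinBFSReach.exists_length G r _ le_rfl
    have hs := (MinBFSReach.sorted hp hσ hr h).1
    have hnd : (L ++ Q).Nodup := hs.imp fun hlt e => by
      rw [e] at hlt; exact lt_irrefl _ hlt
    have hQ : Q = [] := by
      have := hnd.length_le_card
      rw [List.length_append, hlen] at this
      exact List.eq_nil_of_length_eq_zero (by omega)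
    subst hQ
    rw [List.append_nil] at hs
    rw [IsMinBFSOrdering, ← eq_ofFn_of_pairwise_lt hs hlen]
    exact h

/-- The left ordering of a prime graph is unique up to reversal. -/
theorem IsPrimeGraph.isLeftOrdering_iff [Nonempty V] (hp : IsPrimeGraph G)
    (hσ : IsLeftOrdering G σ) : IsLeftOrdering G τ ↔ τ = σ ∨ τ = mirror σ := by
  classical
  constructor
  · intro hτ
    -- `τ` is a minBFS output from `r`, and every such output is `σ` or its mirror, according to
    -- which end `r` is.
    obtain ⟨r, hr⟩ := exists_first τ
    have h := (hp.isMinBFSOrdering_iff hτ hr).2 rfl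
    exact (hp.first_eq_end hσ hτ hr).imp (fun h' => (hp.isMinBFSOrdering_iff hσ h').1 h)
      fun h' => (hp.isMinBFSOrdering_iff hσ.mirror h').1 h
  · rintro (rfl | rfl)
    exacts [hσ, hσ.mirror]

end Search

/-! ### Realizers, interval orderings and anchors -/

section Realizers

variable {V : Type*} {G : SimpleGraph V} {l : V → ℝ}

theorem isRealizer_iff : IsRealizer G l ↔ ∀ u v, u ≠ v → (G.Adj u v ↔ |l u - l v| ≤ 1) := by
  refine forall_congr' fun u => forall_congr' fun v => imp_congr_right fun _ => ?_
  rw [unitLengthInterval, unitLengthInterval, Set.Icc_inter_Icc, Set.nonempty_Icc, sup_le_iff,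
    le_inf_iff, le_inf_iff, abs_le]
  refine iff_congr Iff.rfl ⟨fun h => ⟨by linarith [h.2.1], by linarith [h.1.2]⟩, fun h =>
    ⟨⟨by linarith, by linarith⟩, by linarith, by linarith⟩⟩

theorem IsRealizer.neg (h : IsRealizer G l) : IsRealizer G fun v => -l v := by
  rw [isRealizer_iff] at *
  intro u v huv
  rw [h u v huv, neg_sub_neg, abs_sub_comm]

variable [Fintype V] {σ τ : VOrdering V}

theorem IsIntervalOrdering.mirror (h : IsIntervalOrdering G τ) :
    IsIntervalOrdering G (mirror τ) := by
  obtain ⟨l, hl, hm⟩ := h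
  exact ⟨_, hl.neg, fun u v huv => neg_le_neg (hm v u (mirror_lt_mirror.1 huv))⟩

theorem IsIntervalOrdering.isLeftOrdering (h : IsIntervalOrdering G τ) : IsLeftOrdering G τ := by
  obtain ⟨l, hl, hm⟩ := h
  rw [isRealizer_iff] at hl
  intro a b c hab hbc hac
  have hab' : a ≠ b := by rintro rfl; exact lt_irrefl _ hab
  have hbc' : b ≠ c := by rintro rfl; exact lt_irrefl _ hbc
  have h1 := hm a b hab
  have h2 := hm b c hbc
  rw [hl a b hab', hl b c hbc']
  rw [hl a c hac.ne] at hac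
  simp only [abs_le] at *
  exact ⟨⟨by linarith, by linarith⟩, by linarith, by linarith⟩

theorem exists_sorted_ordering (l : V → ℝ) : ∃ τ : VOrdering V, ∀ u v, τ u < τ v → l u ≤ l v := by
  let e := Fintype.equivFin V
  refine ⟨e.trans (Tuple.sort (l ∘ e.symm)).symm, fun u v huv => ?_⟩
  have := Tuple.monotone_sort (l ∘ e.symm) huv.le
  simpa using this

theorem IsIntervalOrdering.isAnchor (h : IsIntervalOrdering G τ) {r : V} (hr : ∀ v, τ r ≤ τ v) :
    IsAnchor G r := by
  obtain ⟨l, hl, hm⟩ := h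
  refine ⟨l, hl, fun v => ?_⟩
  rcases (hr v).eq_or_lt with e | hlt
  · rw [τ.injective e]
  · exact hm r v hlt

/-- An anchor of a prime graph is an end of any left ordering. -/
theorem IsAnchor.eq_end [Nonempty V] (hp : IsPrimeGraph G) (hσ : IsLeftOrdering G σ) {r : V}
    (h : IsAnchor G r) : (∀ v, σ r ≤ σ v) ∨ ∀ v, mirror σ r ≤ mirror σ v := by
  obtain ⟨l, hl, hr⟩ := h
  obtain ⟨τ, hτ⟩ := exists_sorted_ordering l
  have hi : IsIntervalOrdering G τ := ⟨l, hl, hτ⟩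
  obtain ⟨f, hf⟩ := exists_first τ
  by_cases hrf : r = f
  · exact hp.first_eq_end hσ hi.isLeftOrdering (hrf ▸ hf)
  · have hlt : τ f < τ r := lt_of_le_of_ne (hf r) fun e => hrf (τ.injective e).symm
    -- An anchor may tie with the first sorted vertex; equal intervals make them twins.
    have heq : l r = l f := le_antisymm (hr f) (hτ f r hlt)
    rw [isRealizer_iff] at hl
    refine (hp.atMostTwo_of_twins hrf fun z hzr hzf => ?_).eq_end r
    rw [hl r z hzr.symm, hl f z hzf.symm, heq]

end Realizers

end UIGOrder

open UIGOrder in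
theorem mainTheorem3 {V : Type*} [Fintype V] [Nonempty V]
    (G : SimpleGraph V) [DecidableRel G.Adj]
    (hprime : UIGOrder.IsPrimeGraph G) (huig : UIGOrder.IsUIG G) :
    ∃ σ : UIGOrder.VOrdering V, ∀ τ : UIGOrder.VOrdering V,
      (UIGOrder.IsIntervalOrdering G τ ↔ τ = σ ∨ τ = UIGOrder.mirror σ) ∧
      (UIGOrder.IsConsecutiveNeighbourhoodOrdering G τ ↔ τ = σ ∨ τ = UIGOrder.mirror σ) ∧
      (UIGOrder.IsLeftOrdering G τ ↔ τ = σ ∨ τ = UIGOrder.mirror σ) ∧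
      ((∃ r, UIGOrder.IsAnchor G r ∧ UIGOrder.IsMinBFSOrdering G r τ) ↔
        τ = σ ∨ τ = UIGOrder.mirror σ) ∧
      (UIGOrder.IsIndifferenceOrdering G τ ↔ τ = σ ∨ τ = UIGOrder.mirror σ) ∧
      (UIGOrder.IsBisimplicialEliminationOrdering G τ ↔ τ = σ ∨ τ = UIGOrder.mirror σ) := by
  obtain ⟨l, hl⟩ := huig
  obtain ⟨σ, hσl⟩ := exists_sorted_ordering l
  have hσi : IsIntervalOrdering G σ := ⟨l, hl, hσl⟩
  have hσ := hσi.isLeftOrdering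
  refine ⟨σ, fun τ => ?_⟩
  have hleft := hprime.isLeftOrdering_iff (τ := τ) hσ
  have hinterval : τ = σ ∨ τ = mirror σ → IsIntervalOrdering G τ := by
    rintro (rfl | rfl)
    exacts [hσi, hσi.mirror]
  rw [isBisimplicialEliminationOrdering_iff, hprime.isIndifferenceOrdering_iff,
    isConsecutiveNeighbourhoodOrdering_iff]
  refine ⟨⟨fun h => hleft.1 h.isLeftOrdering, hinterval⟩, hleft, hleft, ⟨?_, fun h => ?_⟩,
    hleft, hleft⟩
  · rintro ⟨r, hr, hτ⟩
    exact (hr.eq_end hprime hσ).imp (fun h => (hprime.isMinBFSOrdering_iff hσ h).1 hτ)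
      fun h => (hprime.isMinBFSOrdering_iff hσ.mirror h).1 hτ
  · obtain ⟨r, hr⟩ := exists_first τ
    exact ⟨r, (hinterval h).isAnchor hr,
      (hprime.isMinBFSOrdering_iff (hinterval h).isLeftOrdering hr).2 rfl⟩
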